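/- Let $\mathcal T$ be a finite conforming triangulation of a polytope $\Omega\subset\mathbb R^d$ (an open set) into $m$ nondegenerate simplices $K_1,\dots,K_m$, with vertices $v_k$, nodal (hat) basis functions $\phi_k$, volumes $\omega_i=|K_i|$ and barycentres $x^{(i)}$ of $K_i$. Let $V_h$ be the space of continuous piecewise linear functions $u=\sum_{v_k\in\Omega}u_k\phi_k$ vanishing on $\partial\Omega$, identified with the vectors $(u_k)_{v_k\in\Omega}$; let $g=\sum_k g_k\phi_k$ be continuous and piecewise linear, and let $f$ be integrable on $\Omega$. Put $D^{(j)}_{i,k}=\frac{\partial\phi_k}{\partial x_j}(x^{(i)})$, so that $(D^{(j)}u)_i$ is the $j$-th component of the constant gradient $\nabla u|_{K_i}$. Let $1\le p<\infty$, $R\in\mathbb R$, $\sigma=2$ if $p<2$ and $\sigma=1$ if $p\ge 2$, and for $(u,s)\in V_h\times\mathbb R^m$ put $$F_p(u,s)=-\sum_{i=1}^m\log z_i-\sigma\sum_{i=1}^m\log s_i-\sum_{i=1}^m\log\tau_i,\qquad z_i=s_i^{2/p}-\sum_{j=1}^d\big[(D^{(j)}u+D^{(j)}g)_i\big]^2,\quad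 \tau_i=R-\omega_is_i,$$ $$Q=\Big\{(u,s)\in V_h\times\mathbb R^m:\ s_i\ge\|\nabla(u+g)|_{K_i}\|_2^p,\ s_i\ge0\ \text{ for all }i,\ \text{ and }\ \max_i\omega_is_i\le R\Big\}.$$ **(i)** If $Q$ has nonempty interior, then $F_p$ is an $m(\sigma+2)$-self-concordant barrier for $Q$. That is, $Q$ is closed and convex, $F_p$ is convex and $C^3$ on $\operatorname{int}Q$, tends to $+\infty$ at $\partial Q$, and, for all $x\in\operatorname{int}Q$ and all directions $h$, $|D^3F_p(x)[h,h,h]|\le 2\,(D^2F_p(x)[h,h])^{3/2}$ and $(DF_p(x)[h])^2\le m(\sigma+2)\,D^2F_p(x)[h,h]$. **(ii)** Let $J(u)=\frac1p\int_\Omega\|\nabla(u+g)\|_2^p\,dx-\int_\Omega fu\,dx$ and $U=\{u\in V_h:\ \max_i\omega_i\|\nabla(u+g)|_{K_i}\|_2^p\le R\}$. The problem of minimizing $J$ over $U$ is equivalent to the problem $$\min c^Tx\ \text{ subject to }\ x=(u,s)\in Q,\qquad c=\begin{bmatrix}-\big(\int_\Omega f\phi_k\,dx\big)_{v_k\in\Omega}\\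 \tfrac1p\,(\omega_i)_{i=1}^m\end{bmatrix}.$$ That is: $U$ is the projection of $Q$ to $V_h$; for each $u\in U$, $J(u)$ is the least value of $c^T(u,s)$ over all $s$ with $(u,s)\in Q$; $(u,s)$ minimizes $c^Tx$ over $Q$ if and only if $u$ minimizes $J$ over $U$ and $s_i=\|\nabla(u+g)|_{K_i}\|_2^p$ for all $i$; and the two problems have the same infimum. -/

import Mathlib

open Set Filter Topology MeasureTheory

noncomputable section

/-! ## Self-concordant barriers -/

/-- The `k`-th differential `D^k F(x)[h, …, h]` of `F` at `x` along `h`, i.e. the `k`-th derivative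
at `t = 0` of `t ↦ F (x + t h)`. -/
def dirDeriv {E : Type*} [NormedAddCommGroup E] [NormedSpace ℝ E]
    (k : ℕ) (F : E → ℝ) (x h : E) : ℝ :=
  iteratedDeriv k (fun t : ℝ => F (x + t • h)) 0

/-- `F` is a (standard) `ν`-self-concordant barrier for the closed convex set `Q`: it is a `C³`
convex function on the interior of `Q` (which is nonempty), tends to `+∞` at the boundary of `Q`,
and satisfies `|D³F(x)[h,h,h]| ≤ 2 (D²F(x)[h,h])^{3/2}` and `(DF(x)[h])² ≤ ν D²F(x)[h,h]`
for all `x` in the interior of `Q` and all directions `h`.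
The values of `F` outside the interior of `Q` play no role. -/
structure IsSelfConcordantBarrier {E : Type*} [NormedAddCommGroup E] [NormedSpace ℝ E]
    (F : E → ℝ) (Q : Set E) (ν : ℝ) : Prop where
  isClosed : IsClosed Q
  convex : Convex ℝ Q
  nonempty_interior : (interior Q).Nonempty
  contDiffOn : ContDiffOn ℝ 3 F (interior Q)
  convexOn : ConvexOn ℝ (interior Q) F
  tendsto_atTop : ∀ y ∈ frontier Q, Tendsto F (𝓝[interior Q] y) atTop
  selfConcordant : ∀ x ∈ interior Q, ∀ h : E,
    |dirDeriv 3 F x h| ≤ 2 * (dirDeriv 2 F x h) ^ (3 / 2 : ℝ)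
  barrier : ∀ x ∈ interior Q, ∀ h : E,
    (dirDeriv 1 F x h) ^ 2 ≤ ν * dirDeriv 2 F x h

/-! ## Triangulations and piecewise linear finite elements -/

/-- A (finite, conforming) triangulation by `d`-simplices of a polytope in `ℝ^d`. -/
structure Triangulation (d : ℕ) where
  /-- number of vertices, including those on the boundary -/
  numNodes : ℕ
  /-- number `m` of simplices -/
  numCells : ℕ
  /-- coordinates of the vertices -/
  node : Fin numNodes → EuclideanSpace ℝ (Fin d)
  node_injective : Function.Injective node
  /-- the `d + 1` vertices of each simplex -/
  cell : Fin numCells → Fin (d + 1) → Fin numNodes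
  /-- the simplices are nondegenerate -/
  affineIndependent : ∀ i, AffineIndependent ℝ (fun a => node (cell i a))
  /-- different simplices have different vertex sets -/
  cell_injective : ∀ i j, range (cell i) = range (cell j) → i = j
  /-- two simplices meet in their common face (possibly empty) -/
  conforming : ∀ i j,
    convexHull ℝ (node '' range (cell i)) ∩ convexHull ℝ (node '' range (cell j)) =
      convexHull ℝ (node '' (range (cell i) ∩ range (cell j)))
  /-- each vertex is a vertex of a simplex -/
  exists_cell : ∀ k, ∃ i, k ∈ range (cell i)

namespace Triangulation

variable {d : ℕ} (T : Triangulation d)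

/-- The closed simplex `K_i`. -/
def simplex (i : Fin T.numCells) : Set (EuclideanSpace ℝ (Fin d)) :=
  convexHull ℝ (T.node '' range (T.cell i))

/-- The triangulated polytope `Ω`, as an open set. -/
def domain : Set (EuclideanSpace ℝ (Fin d)) :=
  interior (⋃ i, T.simplex i)

/-- The midpoint (barycentre) `x^{(i)}` of the simplex `K_i`. -/
def midpt (i : Fin T.numCells) : EuclideanSpace ℝ (Fin d) :=
  ((d : ℝ) + 1)⁻¹ • ∑ a, T.node (T.cell i a)

/-- The quadrature weight `ω_i`: the volume of the simplex `K_i`. -/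
def weight (i : Fin T.numCells) : ℝ :=
  (volume (T.simplex i)).toReal

/-- The vertices of the simplex `K_i` as an affine basis of `ℝ^d`. -/
def affBasis (i : Fin T.numCells) : AffineBasis (Fin (d + 1)) ℝ (EuclideanSpace ℝ (Fin d)) where
  toFun a := T.node (T.cell i a)
  ind' := T.affineIndependent i
  tot' := (T.affineIndependent i).affineSpan_eq_top_iff_card_eq_finrank_add_one.2 (by simp)

open Classical in
/-- The nodal (hat) basis function `φ_k`: on each simplex it is the barycentric coordinate belonging
to the vertex `k`, or zero if `k` is not a vertex of that simplex. (On the common face of two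
simplices both give the same value, so the choice of a simplex containing `x` is immaterial.)
It is extended by zero outside the closure of `Ω`. -/
def hat (k : Fin T.numNodes) (x : EuclideanSpace ℝ (Fin d)) : ℝ :=
  if h : ∃ i, x ∈ T.simplex i then
    ∑ a, if T.cell h.choose a = k then (T.affBasis h.choose).coord a x else 0
  else 0

/-- The continuous piecewise linear function `∑_k w_k φ_k` with nodal values `w`. -/
def feFun (w : Fin T.numNodes → ℝ) (x : EuclideanSpace ℝ (Fin d)) : ℝ :=
  ∑ k, w k * T.hat k x

/-- The vertices in `Ω`, i.e. those not on the boundary. -/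
abbrev InteriorNode : Type :=
  {k : Fin T.numNodes // T.node k ∈ T.domain}

instance : Fintype T.InteriorNode :=
  Fintype.ofFinite _

/-- The finite element space `V_h` of piecewise linear functions which vanish on the boundary of
`Ω`, each function being represented by its values at the interior vertices. -/
abbrev FESpace : Type :=
  T.InteriorNode → ℝ

open Classical in
/-- The values of an element of `V_h` at all vertices (zero at the boundary vertices). -/
def extend (u : T.FESpace) (k : Fin T.numNodes) : ℝ :=
  if h : T.node k ∈ T.domain then u ⟨k, h⟩ else 0

/-- The discrete derivative matrix, `D^{(j)}_{i,k} = ∂φ_k/∂x_j (x^{(i)})`. -/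
def discDeriv (j : Fin d) : Matrix (Fin T.numCells) (Fin T.numNodes) ℝ :=
  fun i k => fderiv ℝ (T.hat k) (T.midpt i) (EuclideanSpace.single j 1)

/-- The (constant) gradient `∇w|_{K_i}` on the simplex `K_i` of the piecewise linear function with
nodal values `w`. -/
def cellGrad (w : Fin T.numNodes → ℝ) (i : Fin T.numCells) : EuclideanSpace ℝ (Fin d) :=
  gradient (T.feFun w) (T.midpt i)

/-! ## The discrete `p`-Laplacian

Below, `g` is the vector of nodal values of the piecewise linear boundary datum, and `f` is the
forcing. -/

/-- The energy `J(u) = (1/p) ∫_Ω ‖∇(u+g)‖^p - ∫_Ω f u`. -/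
def energy (p : ℝ) (g : Fin T.numNodes → ℝ) (f : EuclideanSpace ℝ (Fin d) → ℝ)
    (u : T.FESpace) : ℝ :=
  (1 / p) * (∫ x in T.domain, ‖gradient (T.feFun (T.extend u + g)) x‖ ^ p)
    - ∫ x in T.domain, f x * T.feFun (T.extend u) x

/-- The elements `u` of `V_h` that satisfy `max_i ω_i ‖∇(u+g)|_{K_i}‖^p ≤ R`. -/
def feasible (p R : ℝ) (g : Fin T.numNodes → ℝ) : Set T.FESpace :=
  {u | ∀ i, T.weight i * ‖T.cellGrad (T.extend u + g) i‖ ^ p ≤ R}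

/-- The set `Q` of all `(u, s)` with `s_i ≥ ‖∇(u+g)|_{K_i}‖^p`, `s_i ≥ 0` and
`max_i ω_i s_i ≤ R`. -/
def setQ (p R : ℝ) (g : Fin T.numNodes → ℝ) : Set (T.FESpace × (Fin T.numCells → ℝ)) :=
  {x | ∀ i, ‖T.cellGrad (T.extend x.1 + g) i‖ ^ p ≤ x.2 i ∧ 0 ≤ x.2 i ∧ T.weight i * x.2 i ≤ R}

/-- `σ(p) = 2` if `p < 2` and `σ(p) = 1` if `p ≥ 2`. -/
def sigma (p : ℝ) : ℝ :=
  if p < 2 then 2 else 1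

/-- `z_i = s_i^{2/p} - ∑_j [(D^{(j)} u + D^{(j)} g)_i]²`. -/
def slackZ (p : ℝ) (g : Fin T.numNodes → ℝ) (x : T.FESpace × (Fin T.numCells → ℝ))
    (i : Fin T.numCells) : ℝ :=
  x.2 i ^ (2 / p)
    - ∑ j, ((T.discDeriv j).mulVec (T.extend x.1) i + (T.discDeriv j).mulVec g i) ^ 2

/-- `τ_i = R - ω_i s_i`. -/
def slackTau (R : ℝ) (x : T.FESpace × (Fin T.numCells → ℝ)) (i : Fin T.numCells) : ℝ :=
  R - T.weight i * x.2 i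

/-- The barrier `F_p(u, s) = - ∑_i log z_i - σ ∑_i log s_i - ∑_i log τ_i`. -/
def barrierF (p R : ℝ) (g : Fin T.numNodes → ℝ) (x : T.FESpace × (Fin T.numCells → ℝ)) : ℝ :=
  -(∑ i, Real.log (T.slackZ p g x i)) - sigma p * (∑ i, Real.log (x.2 i))
    - ∑ i, Real.log (T.slackTau R x i)

/-- The cost vector `c`, with entries `-∫_Ω f φ_k` (for the unknowns `u_k`) and `ω_i / p`
(for the unknowns `s_i`). -/
def costVec (p : ℝ) (f : EuclideanSpace ℝ (Fin d) → ℝ) : T.FESpace × (Fin T.numCells → ℝ) :=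
  (fun k => -∫ y in T.domain, f y * T.hat k.1 y, fun i => T.weight i / p)

/-- The linear function `x ↦ cᵀ x`. -/
def cost (p : ℝ) (f : EuclideanSpace ℝ (Fin d) → ℝ) (x : T.FESpace × (Fin T.numCells → ℝ)) : ℝ :=
  (∑ k, (T.costVec p f).1 k * x.1 k) + ∑ i, (T.costVec p f).2 i * x.2 i

end Triangulation

end

/-! Part (i) is a statement about lines: along `t ↦ x + t h` only three derivatives at `0` matter,
and `HasJet` records them. One cell contributes `-log z - σ log s - log τ`, where `z = s ^ q -
‖y‖²`, `q = 2 / p` and `y` is affine in `u`. If `q ≤ 1`, then `z` is concave. If `q > 1`, one uses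
instead the concave function `z / s = s ^ (q - 1) - ‖y‖² / s` together with `-log z - 2 log s = -log
(z / s) - 3 log s`; this explains `σ = 2` for `p < 2`. Either way the part without `τ` is `-log f -
θ log s` with `f` concave, `θ` equal to `1` or `3`, and `|f'''| ≤ 3 |s' / s| (-f'')`. Under this
compatibility `abs_cubic_le` yields the third-order bound, and `cell_inequalities` verifies it for
each cell.

Adding the cells preserves the third-order bound and multiplies the parameter by `m`. Nonnegative
second differentials along segments give convexity. At a frontier point some `z_i` or `τ_i`
vanishes, so one logarithmic term blows up while the others stay bounded below.

For part (ii), conformity forces a simplex that meets the interior of `K_i` to be `K_i`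
(`eq_of_mem_interior_simplex`). Hat functions are therefore affine on cell interiors, and these fill
the domain up to a null set. Hence `J(u)` is the cost of `(u, s)` with the least admissible `s`
(`energy_eq_cost`), and the cost is strictly increasing in every `s_i`. -/

noncomputable section

/-! ## Third order jets of real functions -/

/-- `φ` is three times differentiable at `0`, with first, second and third derivative `a`, `b`, `c`
there. -/
def HasJet (φ : ℝ → ℝ) (a b c : ℝ) : Prop :=
  ∃ φ₁ φ₂ : ℝ → ℝ, (∀ᶠ t in 𝓝 0, HasDerivAt φ (φ₁ t) t) ∧
    (∀ᶠ t in 𝓝 0, HasDerivAt φ₁ (φ₂ t) t) ∧ HasDerivAt φ₂ c 0 ∧ φ₁ 0 = a ∧ φ₂ 0 = b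

namespace HasJet

variable {φ ψ : ℝ → ℝ} {a b c a' b' c' : ℝ}

lemma iteratedDeriv_eq (h : HasJet φ a b c) :
    iteratedDeriv 1 φ 0 = a ∧ iteratedDeriv 2 φ 0 = b ∧ iteratedDeriv 3 φ 0 = c := by
  obtain ⟨φ₁, φ₂, h₁, h₂, h₃, rfl, rfl⟩ := h
  have e₁ : deriv φ =ᶠ[𝓝 0] φ₁ := h₁.mono fun t ht => ht.deriv
  have e₂ : deriv φ₁ =ᶠ[𝓝 0] φ₂ := h₂.mono fun t ht => ht.deriv
  have e₃ : deriv (deriv φ) =ᶠ[𝓝 0] φ₂ := e₁.deriv.trans e₂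
  refine ⟨?_, ?_, ?_⟩
  · rw [iteratedDeriv_one]; exact e₁.eq_of_nhds
  · rw [iteratedDeriv_succ, iteratedDeriv_one]; exact e₃.eq_of_nhds
  · rw [iteratedDeriv_succ, iteratedDeriv_succ, iteratedDeriv_one, e₃.deriv_eq, h₃.deriv]

lemma add (h : HasJet φ a b c) (h' : HasJet ψ a' b' c') :
    HasJet (fun t => φ t + ψ t) (a + a') (b + b') (c + c') := by
  obtain ⟨φ₁, φ₂, h₁, h₂, h₃, rfl, rfl⟩ := h
  obtain ⟨ψ₁, ψ₂, k₁, k₂, k₃, rfl, rfl⟩ := h'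
  refine ⟨fun t => φ₁ t + ψ₁ t, fun t => φ₂ t + ψ₂ t, ?_, ?_, h₃.add k₃, rfl, rfl⟩
  · filter_upwards [h₁, k₁] with t x y using x.add y
  · filter_upwards [h₂, k₂] with t x y using x.add y

lemma const_mul (r : ℝ) (h : HasJet φ a b c) :
    HasJet (fun t => r * φ t) (r * a) (r * b) (r * c) := by
  obtain ⟨φ₁, φ₂, h₁, h₂, h₃, rfl, rfl⟩ := h
  refine ⟨fun t => r * φ₁ t, fun t => r * φ₂ t, ?_, ?_, h₃.const_mul r, rfl, rfl⟩
  · filter_upwards [h₁] with t x using x.const_mul r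
  · filter_upwards [h₂] with t x using x.const_mul r

lemma sub (h : HasJet φ a b c) (h' : HasJet ψ a' b' c') :
    HasJet (fun t => φ t - ψ t) (a - a') (b - b') (c - c') := by
  have := h.add (h'.const_mul (-1))
  simpa [sub_eq_add_neg] using this

lemma sum {ι : Type*} (s : Finset ι) {φ : ι → ℝ → ℝ} {a b c : ι → ℝ}
    (h : ∀ i ∈ s, HasJet (φ i) (a i) (b i) (c i)) :
    HasJet (fun t => ∑ i ∈ s, φ i t) (∑ i ∈ s, a i) (∑ i ∈ s, b i) (∑ i ∈ s, c i) := by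
  classical
  induction s using Finset.induction_on with
  | empty =>
    simp only [Finset.sum_empty]
    exact ⟨fun _ => 0, fun _ => 0, .of_forall fun t => hasDerivAt_const t 0,
      .of_forall fun t => hasDerivAt_const t 0, hasDerivAt_const 0 0, rfl, rfl⟩
  | insert i s hi ih =>
    simp only [Finset.sum_insert hi]
    exact (h i (Finset.mem_insert_self i s)).add
      (ih fun j hj => h j (Finset.mem_insert_of_mem hj))

lemma continuousAt (h : HasJet φ a b c) : ContinuousAt φ 0 := by
  obtain ⟨φ₁, φ₂, h₁, -⟩ := h
  exact h₁.self_of_nhds.continuousAt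

lemma log (h : HasJet φ a b c) (h0 : 0 < φ 0) :
    HasJet (fun t => Real.log (φ t)) (a / φ 0) (b / φ 0 - (a / φ 0) ^ 2)
      (c / φ 0 - 3 * (a / φ 0) * (b / φ 0) + 2 * (a / φ 0) ^ 3) := by
  have hpos : ∀ᶠ t in 𝓝 0, 0 < φ t := h.continuousAt.eventually (lt_mem_nhds h0)
  obtain ⟨φ₁, φ₂, h₁, h₂, h₃, rfl, rfl⟩ := h
  refine ⟨fun t => φ₁ t / φ t, fun t => φ₂ t / φ t - (φ₁ t / φ t) ^ 2, ?_, ?_, ?_, rfl, rfl⟩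
  · filter_upwards [h₁, hpos] with t x y using x.log y.ne'
  · filter_upwards [h₁, h₂, hpos] with t x y z
    refine (y.div x z.ne').congr_deriv ?_
    field_simp
  · have h0' := h0.ne'
    have k₁ := h₁.self_of_nhds
    have k₂ := h₂.self_of_nhds
    refine ((h₃.div k₁ h0.ne').sub ((k₂.div k₁ h0.ne').pow 2)).congr_deriv ?_
    simp only [Pi.div_apply, Nat.cast_ofNat, Nat.add_one_sub_one, pow_one]
    field_simp
    ring

lemma affine (s η : ℝ) : HasJet (fun t => s + t * η) η 0 0 :=
  ⟨fun _ => η, fun _ => 0,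
    .of_forall fun t => by simpa using ((hasDerivAt_id t).mul_const η).const_add s,
    .of_forall fun t => hasDerivAt_const t η, hasDerivAt_const 0 0, rfl, rfl⟩

lemma quadratic (A B C : ℝ) : HasJet (fun t => A + 2 * t * B + t ^ 2 * C) (2 * B) (2 * C) 0 := by
  refine ⟨fun t => 2 * B + 2 * t * C, fun _ => 2 * C, .of_forall fun t => ?_,
    .of_forall fun t => ?_, hasDerivAt_const 0 _, by simp, rfl⟩
  · have h := ((((hasDerivAt_id t).const_mul 2).mul_const B).const_add A).add
      (((hasDerivAt_id t).pow 2).mul_const C)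
    refine h.congr_deriv ?_
    simp
  · have h := (((hasDerivAt_id t).const_mul 2).mul_const C).const_add (2 * B)
    refine h.congr_deriv ?_
    simp

lemma rpow {s : ℝ} (hs : 0 < s) (η q : ℝ) :
    HasJet (fun t => (s + t * η) ^ q) (q * s ^ q * (η / s)) (q * (q - 1) * s ^ q * (η / s) ^ 2)
      (q * (q - 1) * (q - 2) * s ^ q * (η / s) ^ 3) := by
  have hpos : ∀ᶠ t in 𝓝 (0 : ℝ), 0 < s + t * η :=
    (affine s η).continuousAt.eventually (lt_mem_nhds (by simpa using hs))
  have hd : ∀ t : ℝ, HasDerivAt (fun t => s + t * η) η t := fun t => by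
    simpa using ((hasDerivAt_id t).mul_const η).const_add s
  have hs' : s + 0 * η = s := by ring
  refine ⟨fun t => η * q * (s + t * η) ^ (q - 1),
    fun t => η * q * (η * (q - 1) * (s + t * η) ^ (q - 1 - 1)), ?_, ?_, ?_, ?_, ?_⟩
  · filter_upwards [hpos] with t ht using (hd t).rpow_const (Or.inl ht.ne')
  · filter_upwards [hpos] with t ht using ((hd t).rpow_const (Or.inl ht.ne')).const_mul _
  · refine ((((hd 0).rpow_const (p := q - 1 - 1)
      (Or.inl (by rw [hs']; exact hs.ne'))).const_mul (η * (q - 1))).const_mul (η * q)).congr_deriv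
        ?_
    rw [hs']
    simp only [Real.rpow_sub_one hs.ne']
    field_simp
    ring
  · simp only [hs', Real.rpow_sub_one hs.ne']
    field_simp
  · simp only [hs', Real.rpow_sub_one hs.ne']
    field_simp

end HasJet

/-! ## The inequalities between the differentials -/

/-- The third-order inequality for the barrier `-log f - θ log s`, where `α = f'/f`, `β = -f''/f`,
`γ = f'''/f` and `r = s'/s`. -/
lemma abs_cubic_le {α r β γ θ : ℝ} (hθ : 1 ≤ θ) (hβ : 0 ≤ β) (hγ : |γ| ≤ 3 * |r| * β) :
    |2 * α ^ 3 + 3 * α * β + γ + 2 * θ * r ^ 3| ≤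
      2 * ((α ^ 2 + β + θ * r ^ 2) * √(α ^ 2 + β + θ * r ^ 2)) := by
  have hD : 0 ≤ α ^ 2 + β + θ * r ^ 2 := by positivity
  set N := √(α ^ 2 + β + θ * r ^ 2) with hN
  have hN0 : 0 ≤ N := Real.sqrt_nonneg _
  have hN2 : N ^ 2 = α ^ 2 + β + θ * r ^ 2 := Real.sq_sqrt hD
  have hκ : 1 ≤ √θ := by rw [Real.one_le_sqrt]; exact hθ
  have hκ2 : √θ ^ 2 = θ := Real.sq_sqrt (by linarith)
  set A := |α| with hA
  have hA0 : 0 ≤ A := abs_nonneg _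
  have hA2 : A ^ 2 = α ^ 2 := sq_abs _
  set ρ := |r| with hρ
  have hρ0 : 0 ≤ ρ := abs_nonneg _
  have hρ2 : ρ ^ 2 = r ^ 2 := sq_abs _
  set P := √θ * ρ with hP
  have hPρ : ρ ≤ P := by rw [hP]; nlinarith
  have hP2 : P ^ 2 = θ * r ^ 2 := by rw [hP, mul_pow, hκ2, hρ2]
  have h1 : |2 * α ^ 3 + 3 * α * β + γ + 2 * θ * r ^ 3| ≤
      2 * A ^ 3 + 3 * A * β + 3 * ρ * β + 2 * (P ^ 2 * ρ) := by
    have e1 : |2 * α ^ 3| = 2 * A ^ 3 := by rw [abs_mul, abs_pow, abs_two]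
    have e2 : |3 * α * β| = 3 * A * β := by
      rw [abs_mul, abs_mul, abs_of_nonneg hβ, abs_of_pos (by norm_num : (0 : ℝ) < 3)]
    have e3 : |2 * θ * r ^ 3| = 2 * (P ^ 2 * ρ) := by
      rw [abs_mul, abs_pow, abs_of_nonneg (by linarith : (0 : ℝ) ≤ 2 * θ), hP2, ← hρ2]; ring
    have := abs_add_le (2 * α ^ 3 + 3 * α * β + γ) (2 * θ * r ^ 3)
    have := abs_add_le (2 * α ^ 3 + 3 * α * β) γ
    have := abs_add_le (2 * α ^ 3) (3 * α * β)
    linarith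
  have h2 : 3 * ρ * β ≤ 3 * P * β := by gcongr
  have h3 : P ^ 2 * ρ ≤ P ^ 2 * P := by gcongr
  -- With `S = A + P` this product is `S³ - 3 N² S + 2 N³`, so the bound `S (3 N² - S²)` left after
  -- eliminating `β` is at most `2 N³`.
  have h4 : 0 ≤ (A + P - N) ^ 2 * (A + P + 2 * N) := by positivity
  have h5 : β = N ^ 2 - A ^ 2 - P ^ 2 := by linarith
  rw [← hN2]
  calc _ ≤ _ := h1
    _ ≤ 2 * A ^ 3 + 3 * A * β + 3 * P * β + 2 * (P ^ 2 * P) := by linarith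
    _ = (A + P) * (3 * N ^ 2 - (A + P) ^ 2) := by rw [h5]; ring
    _ ≤ _ := by nlinarith [h4]

/-- Plain Cauchy-Schwarz for `-log f - 3 log s - log τ` would give the constant `1 + 3 + 1 = 5`.
Since `τ` decreases as `s` grows, `-3 r` and `e r` have opposite signs, which saves one. -/
lemma sq_first_le {α r β e : ℝ} (hβ : 0 ≤ β) (he : 0 ≤ e) :
    (-(α + 3 * r) + e * r) ^ 2 ≤ 4 * (α ^ 2 + β + 3 * r ^ 2 + (e * r) ^ 2) := by
  have key : 4 * (α ^ 2 + β + 3 * r ^ 2 + (e * r) ^ 2) - (-(α + 3 * r) + e * r) ^ 2 =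
      3 * (α - r) ^ 2 + 4 * β + 2 * (e * (α * r)) + 6 * (e * r ^ 2) + 3 * (e * r) ^ 2 := by ring
  have key' : 3 * (α - r) ^ 2 + 4 * β + 2 * (e * (α * r)) + 6 * (e * r ^ 2) + 3 * (e * r) ^ 2 =
      2 * α ^ 2 + 3 * r ^ 2 - 6 * (α * r) + 4 * β + (α + e * r) ^ 2 + 6 * (e * r ^ 2)
        + 2 * (e * r) ^ 2 := by ring
  have h1 : 0 ≤ e * r ^ 2 := by positivity
  -- The expansion `key'` absorbs a nonpositive `α r`; the one before it absorbs a nonnegative one.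
  rcases le_total 0 (α * r) with h | h
  · have h2 : 0 ≤ e * (α * r) := by positivity
    have : 0 ≤ 3 * (α - r) ^ 2 + 3 * (e * r) ^ 2 := by positivity
    linarith
  · have : 0 ≤ 2 * α ^ 2 + 3 * r ^ 2 + (α + e * r) ^ 2 + 2 * (e * r) ^ 2 := by positivity
    linarith

/-- The inequalities for `-log z - σ log s - log τ` with `z = s ^ q - ‖y‖²`. Here `κ = s ^ q / z`,
`k = ‖y‖² / z`, `B = ⟪y, v⟫ / z`, `C = ‖v‖² / z`, `r = s' / s`, `w = -τ' / τ = e r`. -/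
lemma cell_inequalities {q σ κ k B C r e a₁ a₂ a₃ w : ℝ} (hq0 : 0 < q) (hq2 : q ≤ 2)
    (hσ : σ = if 1 < q then 2 else 1) (hκ : κ = 1 + k) (hk : 0 ≤ k) (hC : 0 ≤ C)
    (hB : 0 ≤ C - 2 * B * r + k * r ^ 2) (he : 0 ≤ e) (hw : w = e * r)
    (ha₁ : a₁ = q * κ * r - 2 * B) (ha₂ : a₂ = q * (q - 1) * κ * r ^ 2 - 2 * C)
    (ha₃ : a₃ = q * (q - 1) * (q - 2) * κ * r ^ 3) :
    (-a₁ - σ * r + w) ^ 2 ≤ (σ + 2) * (-(a₂ - a₁ ^ 2) + σ * r ^ 2 + w ^ 2) ∧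
    0 ≤ -(a₂ - a₁ ^ 2) + σ * r ^ 2 + w ^ 2 ∧
    |-(a₃ - 3 * a₁ * a₂ + 2 * a₁ ^ 3) - σ * (2 * r ^ 3)| ≤
      2 * ((-(a₂ - a₁ ^ 2) + σ * r ^ 2) * √(-(a₂ - a₁ ^ 2) + σ * r ^ 2)) ∧
    0 ≤ -(a₂ - a₁ ^ 2) + σ * r ^ 2 := by
  have hκ0 : 0 ≤ κ := by linarith
  by_cases h : 1 < q
  · rw [if_pos h] at hσ
    subst hσ
    -- Here `f = z / s`: `α`, `β`, `γ` are `f' / f`, `-f'' / f`, `f''' / f`, and `W` stands for `‖v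
    -- - r y‖² / z`.
    set W := C - 2 * B * r + k * r ^ 2 with hW
    set α := a₁ - r with hα
    set β := (q - 1) * (2 - q) * κ * r ^ 2 + 2 * W with hβ
    set γ := (q - 1) * (2 - q) * (3 - q) * κ * r ^ 3 + 6 * r * W with hγ
    have hl : 0 ≤ (q - 1) * (2 - q) := mul_nonneg (by linarith) (by linarith)
    have hβ0 : 0 ≤ β := by
      have : 0 ≤ (q - 1) * (2 - q) * (κ * r ^ 2) := by positivity
      rw [hβ]; linarith
    have e2 : -(a₂ - a₁ ^ 2) + 2 * r ^ 2 = α ^ 2 + β + 3 * r ^ 2 := by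
      rw [hβ, hW, hα, ha₂, ha₁, hκ]; ring
    have e3 : -(a₃ - 3 * a₁ * a₂ + 2 * a₁ ^ 3) - 2 * (2 * r ^ 3) =
        -(2 * α ^ 3 + 3 * α * β + γ + 2 * 3 * r ^ 3) := by
      rw [hγ, hβ, hW, hα, ha₃, ha₂, ha₁, hκ]; ring
    -- The `W` terms match exactly, `6 W = 3 (2 W)`; for the power term `3 - q ≤ 3` suffices.
    have hγβ : |γ| ≤ 3 * |r| * β := by
      have : γ = r * ((q - 1) * (2 - q) * (3 - q) * (κ * r ^ 2) + 6 * W) := by rw [hγ]; ring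
      have h0 : 0 ≤ (q - 1) * (2 - q) * (κ * r ^ 2) := by positivity
      have h1 : 0 ≤ (q - 1) * (2 - q) * (3 - q) * (κ * r ^ 2) + 6 * W := by nlinarith
      rw [this, abs_mul, abs_of_nonneg h1]
      have : (q - 1) * (2 - q) * (3 - q) * (κ * r ^ 2) + 6 * W ≤ 3 * β := by
        rw [hβ]; nlinarith
      nlinarith [abs_nonneg r]
    have hnn : 0 ≤ α ^ 2 + β + 3 * r ^ 2 := by positivity
    refine ⟨?_, ?_, ?_, ?_⟩
    · rw [e2, hw]
      have e1 : -a₁ - 2 * r + e * r = -(α + 3 * r) + e * r := by rw [hα]; ring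
      rw [e1]
      have := sq_first_le (α := α) (r := r) hβ0 he
      norm_num
      linarith
    · rw [e2]; positivity
    · rw [e2, e3, abs_neg]
      exact abs_cubic_le (by norm_num) hβ0 hγβ
    · rw [e2]; exact hnn
  · rw [if_neg h] at hσ
    subst hσ
    push Not at h
    -- Now `f = z` is itself concave, and `θ = 1`.
    set β := -a₂ with hβ
    have hl : 0 ≤ q * (1 - q) := mul_nonneg hq0.le (by linarith)
    have hl' : 0 ≤ q * (1 - q) * (κ * r ^ 2) := by positivity
    have hβ' : β = q * (1 - q) * (κ * r ^ 2) + 2 * C := by rw [hβ, ha₂]; ring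
    have hβ0 : 0 ≤ β := by rw [hβ']; linarith
    have e2 : -(a₂ - a₁ ^ 2) + 1 * r ^ 2 = a₁ ^ 2 + β + 1 * r ^ 2 := by rw [hβ]; ring
    have e3 : -(a₃ - 3 * a₁ * a₂ + 2 * a₁ ^ 3) - 1 * (2 * r ^ 3) =
        -(2 * a₁ ^ 3 + 3 * a₁ * β + a₃ + 2 * 1 * r ^ 3) := by rw [hβ]; ring
    have hγβ : |a₃| ≤ 3 * |r| * β := by
      have : a₃ = r * (q * (1 - q) * (κ * r ^ 2) * (2 - q)) := by rw [ha₃]; ring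
      have h1 : 0 ≤ q * (1 - q) * (κ * r ^ 2) * (2 - q) := mul_nonneg hl' (by linarith)
      rw [this, abs_mul, abs_of_nonneg h1]
      have : q * (1 - q) * (κ * r ^ 2) * (2 - q) ≤ 3 * β := by
        rw [hβ']; nlinarith
      nlinarith [abs_nonneg r]
    refine ⟨?_, ?_, ?_, ?_⟩
    · rw [e2]
      clear_value β
      clear e2 e3 hγβ hl hl' hβ' ha₁ ha₂ ha₃ hw
      -- Cauchy-Schwarz for the three summands `-a₁`, `-r`, `w`: the hints are their squared
      -- differences.
      nlinarith [sq_nonneg (a₁ - r), sq_nonneg (a₁ + w), sq_nonneg (r + w)]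
    · rw [e2]; positivity
    · rw [e2, e3, abs_neg]
      exact abs_cubic_le le_rfl hβ0 hγβ
    · rw [e2]; positivity

/-- Superadditivity of `t ^ (3 / 2)`, by which the third-order inequality passes to sums. -/
lemma sum_mul_sqrt_le {ι : Type*} (s : Finset ι) {x : ι → ℝ} (hx : ∀ i ∈ s, 0 ≤ x i) :
    ∑ i ∈ s, x i * √(x i) ≤ (∑ i ∈ s, x i) * √(∑ i ∈ s, x i) := by
  rw [Finset.sum_mul]
  refine Finset.sum_le_sum fun i hi => ?_
  exact mul_le_mul_of_nonneg_left (Real.sqrt_le_sqrt (Finset.single_le_sum hx hi)) (hx i hi)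

lemma rpow_three_halves {x : ℝ} (hx : 0 ≤ x) : x ^ (3 / 2 : ℝ) = x * √x := by
  rcases hx.eq_or_lt with rfl | h
  · rw [Real.zero_rpow (by norm_num)]; simp
  · rw [Real.sqrt_eq_rpow, show (3 / 2 : ℝ) = 1 + 1 / 2 by norm_num, Real.rpow_add h, Real.rpow_one]

/-! ## The barrier for a system of `p`-th power epigraphs -/

namespace PowerEpigraph

variable {ι V W : Type*} [NormedAddCommGroup V] [NormedSpace ℝ V]
  [NormedAddCommGroup W] [InnerProductSpace ℝ W]
  (p R : ℝ) (A : ι → V →L[ℝ] W) (b : ι → W) (ω : ι → ℝ)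

/-- The set `{(u, s) : ‖A_i u + b_i‖ ^ p ≤ s_i, ω_i s_i ≤ R}`. -/
def region : Set (V × (ι → ℝ)) :=
  {x | ∀ i, ‖A i x.1 + b i‖ ^ p ≤ x.2 i ∧ 0 ≤ x.2 i ∧ ω i * x.2 i ≤ R}

/-- The slack `s_i ^ (2 / p) - ‖A_i u + b_i‖²`. -/
def slack (x : V × (ι → ℝ)) (i : ι) : ℝ :=
  x.2 i ^ (2 / p) - ‖A i x.1 + b i‖ ^ 2

/-- The contribution of the index `i` to the barrier. -/
def term (x : V × (ι → ℝ)) (i : ι) : ℝ :=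
  -Real.log (slack p A b x i) - Triangulation.sigma p * Real.log (x.2 i)
    - Real.log (R - ω i * x.2 i)

/-- The set of strictly feasible points. -/
def strictRegion : Set (V × (ι → ℝ)) :=
  {x | ∀ i, 0 < slack p A b x i ∧ 0 < x.2 i ∧ 0 < R - ω i * x.2 i}

variable {p R A b ω}

lemma pow_le_iff (hp : 0 < p) {y s : ℝ} (hy : 0 ≤ y) (hs : 0 ≤ s) :
    y ^ p ≤ s ↔ 0 ≤ s ^ (2 / p) - y ^ 2 := by
  have h : (y ^ p) ^ (2 / p) = y ^ 2 := by
    rw [← Real.rpow_mul hy, mul_div_cancel₀ _ hp.ne', Real.rpow_two]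
  rw [sub_nonneg, ← h, Real.rpow_le_rpow_iff (by positivity) hs (by positivity)]

lemma pow_lt_iff (hp : 0 < p) {y s : ℝ} (hy : 0 ≤ y) (hs : 0 ≤ s) :
    y ^ p < s ↔ 0 < s ^ (2 / p) - y ^ 2 := by
  have h : (y ^ p) ^ (2 / p) = y ^ 2 := by
    rw [← Real.rpow_mul hy, mul_div_cancel₀ _ hp.ne', Real.rpow_two]
  rw [sub_pos, ← h, Real.rpow_lt_rpow_iff (by positivity) hs (by positivity)]

lemma mem_region_iff (hp : 0 < p) {x : V × (ι → ℝ)} :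
    x ∈ region p R A b ω ↔ ∀ i, 0 ≤ slack p A b x i ∧ 0 ≤ x.2 i ∧ 0 ≤ R - ω i * x.2 i := by
  refine forall_congr' fun i => ?_
  rw [sub_nonneg]
  constructor
  · rintro ⟨h1, h2, h3⟩
    exact ⟨(pow_le_iff hp (norm_nonneg _) h2).1 h1, h2, h3⟩
  · rintro ⟨h1, h2, h3⟩
    exact ⟨(pow_le_iff hp (norm_nonneg _) h2).2 h1, h2, h3⟩

lemma continuous_slack (hp : 0 < p) (i : ι) : Continuous fun x => slack p A b x i := by
  unfold slack
  have h2 : Continuous fun x : V × (ι → ℝ) => x.2 i := by fun_prop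
  refine (h2.rpow_const fun x => Or.inr (by positivity)).sub ?_
  fun_prop

lemma isClosed_region (hp : 0 < p) : IsClosed (region p R A b ω) := by
  have : region p R A b ω =
      ⋂ i, {x | 0 ≤ slack p A b x i} ∩ {x | 0 ≤ x.2 i} ∩ {x | 0 ≤ R - ω i * x.2 i} := by
    ext x
    simp only [mem_region_iff hp, mem_iInter, mem_inter_iff, mem_ofPred_eq, and_assoc]
  rw [this]
  refine isClosed_iInter fun i => ((isClosed_le continuous_const (continuous_slack hp i)).inter
    (isClosed_le continuous_const (by fun_prop))).inter
    (isClosed_le continuous_const (by fun_prop))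

lemma convex_region (hp : 1 ≤ p) : Convex ℝ (region p R A b ω) := by
  intro x hx y hy α β hα hβ hαβ i
  obtain ⟨x1, x2, x3⟩ := hx i
  obtain ⟨y1, y2, y3⟩ := hy i
  have e2 : (α • x + β • y).2 i = α * x.2 i + β * y.2 i := by simp
  have e1 : A i (α • x + β • y).1 + b i = α • (A i x.1 + b i) + β • (A i y.1 + b i) := by
    have : b i = α • b i + β • b i := by rw [← add_smul, hαβ, one_smul]
    conv_lhs => rw [this]
    simp only [Prod.fst_add, Prod.smul_fst, map_add, map_smul, smul_add]
    abel
  rw [e1, e2]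
  refine ⟨?_, by positivity, ?_⟩
  · calc ‖α • (A i x.1 + b i) + β • (A i y.1 + b i)‖ ^ p
        ≤ (α * ‖A i x.1 + b i‖ + β * ‖A i y.1 + b i‖) ^ p := by
          refine Real.rpow_le_rpow (norm_nonneg _) ?_ (by linarith)
          refine (norm_add_le _ _).trans ?_
          rw [norm_smul, norm_smul, Real.norm_of_nonneg hα, Real.norm_of_nonneg hβ]
      _ ≤ α * ‖A i x.1 + b i‖ ^ p + β * ‖A i y.1 + b i‖ ^ p :=
          (convexOn_rpow hp).2 (norm_nonneg _) (norm_nonneg _) hα hβ hαβ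
      _ ≤ _ := by gcongr
  · calc ω i * (α * x.2 i + β * y.2 i) = α * (ω i * x.2 i) + β * (ω i * y.2 i) := by ring
      _ ≤ α * R + β * R := by gcongr
      _ = R := by rw [← add_mul, hαβ, one_mul]

/-- A term of the barrier, restricted to a line. -/
lemma exists_hasJet_term (hp : 1 ≤ p) (hω : ∀ i, 0 < ω i) {x : V × (ι → ℝ)}
    (hx : x ∈ strictRegion p R A b ω) (h : V × (ι → ℝ)) (i : ι) :
    ∃ a₁ a₂ a₃ : ℝ, HasJet (fun t : ℝ => term p R A b ω (x + t • h) i) a₁ a₂ a₃ ∧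
      a₁ ^ 2 ≤ (Triangulation.sigma p + 2) * a₂ ∧ 0 ≤ a₂ ∧ |a₃| ≤ 2 * (a₂ * √a₂) := by
  obtain ⟨hz, hs, hτ⟩ := hx i
  set s := x.2 i with hs_def
  set η := h.2 i with hη_def
  set y := A i x.1 + b i with hy_def
  set v := A i h.1 with hv_def
  set z := slack p A b x i with hz_def
  set τ := R - ω i * s with hτ_def
  set q := 2 / p with hq_def
  set r := η / s with hr_def
  have hp0 : 0 < p := by linarith
  have hq0 : 0 < q := by positivity
  have hq2 : q ≤ 2 := by rw [hq_def, div_le_iff₀ hp0]; linarith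
  have hσ : Triangulation.sigma p = if 1 < q then 2 else 1 := by
    have : p < 2 ↔ 1 < q := by rw [hq_def, lt_div_iff₀ hp0, one_mul]
    unfold Triangulation.sigma
    simp only [this]
  have hzS : z = s ^ q - ‖y‖ ^ 2 := rfl
  have lineS : ∀ t : ℝ, (x + t • h).2 i = s + t * η := fun t => by simp [hs_def, hη_def]
  have lineY : ∀ t : ℝ, A i (x + t • h).1 + b i = y + t • v := fun t => by
    simp [hy_def, hv_def]; abel
  have js : HasJet (fun t : ℝ => (x + t • h).2 i) η 0 0 := by
    simp only [lineS]; exact HasJet.affine s η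
  have jz : HasJet (fun t : ℝ => slack p A b (x + t • h) i) (q * s ^ q * r - 2 * inner ℝ y v)
      (q * (q - 1) * s ^ q * r ^ 2 - 2 * ‖v‖ ^ 2)
      (q * (q - 1) * (q - 2) * s ^ q * r ^ 3 - 0) := by
    have : ∀ t : ℝ, slack p A b (x + t • h) i =
        (s + t * η) ^ q - (‖y‖ ^ 2 + 2 * t * inner ℝ y v + t ^ 2 * ‖v‖ ^ 2) := fun t => by
      unfold slack
      rw [lineS, lineY, norm_add_sq_real, norm_smul, mul_pow, Real.norm_eq_abs, sq_abs,
        inner_smul_right]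
      ring
    simp only [this]
    exact (HasJet.rpow hs η q).sub (HasJet.quadratic _ _ _)
  have jτ : HasJet (fun t : ℝ => R - ω i * (x + t • h).2 i) (-(ω i * η)) 0 0 := by
    have : ∀ t : ℝ, R - ω i * (x + t • h).2 i = τ + t * (-(ω i * η)) := fun t => by
      rw [lineS, hτ_def]; ring
    simp only [this]; exact HasJet.affine _ _
  have e0 : x + (0 : ℝ) • h = x := by simp
  have lz := jz.log (by simp only [e0]; exact hz)
  have ls := js.log (by simp only [e0]; exact hs)
  have lτ := jτ.log (by simp only [e0]; exact hτ)
  simp only [e0] at lz ls lτ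
  rw [← hz_def] at lz
  rw [← hs_def] at ls
  rw [← hs_def, ← hτ_def] at lτ
  have key := ((lz.const_mul (-1)).sub (ls.const_mul (Triangulation.sigma p))).sub lτ
  set w := ω i * η / τ with hw
  set a₁ := (q * s ^ q * r - 2 * inner ℝ y v) / z with ha₁
  set a₂ := (q * (q - 1) * s ^ q * r ^ 2 - 2 * ‖v‖ ^ 2) / z with ha₂
  set a₃ := (q * (q - 1) * (q - 2) * s ^ q * r ^ 3 - 0) / z with ha₃
  have hz' := hz.ne'
  -- Since `τ' = -ω η`, one has `w = ω η / τ = e r` with `e = ω s / τ ≥ 0`. The quadratic form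
  -- required to be nonnegative is `‖v - r y‖² / z`.
  obtain ⟨c1, c2, c3, c4⟩ := cell_inequalities (q := q) (σ := Triangulation.sigma p)
    (κ := s ^ q / z) (k := ‖y‖ ^ 2 / z) (B := inner ℝ y v / z) (C := ‖v‖ ^ 2 / z) (r := r)
    (e := ω i * s / τ) (a₁ := a₁) (a₂ := a₂) (a₃ := a₃) (w := w) hq0 hq2 hσ
    (by field_simp; rw [hzS]; ring)
    (by positivity) (by positivity)
    (by
      have e : ‖v‖ ^ 2 / z - 2 * (inner ℝ y v / z) * r + ‖y‖ ^ 2 / z * r ^ 2 =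
          ‖v - r • y‖ ^ 2 / z := by
        rw [norm_sub_sq_real, norm_smul, mul_pow, Real.norm_eq_abs, sq_abs, inner_smul_right,
          real_inner_comm]
        field_simp
      rw [e]; positivity)
    (by have := hω i; positivity)
    (by rw [hw, hr_def]; field_simp)
    (by rw [ha₁]; field_simp) (by rw [ha₂]; field_simp) (by rw [ha₃]; field_simp; ring)
  have jet : HasJet (fun t : ℝ => term p R A b ω (x + t • h) i)
      (-a₁ - Triangulation.sigma p * r + w)
      (-(a₂ - a₁ ^ 2) + Triangulation.sigma p * r ^ 2 + w ^ 2)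
      (-(a₃ - 3 * a₁ * a₂ + 2 * a₁ ^ 3) - Triangulation.sigma p * (2 * r ^ 3) + 2 * w ^ 3) := by
    convert key using 1
    · funext t; unfold term; ring
    · rw [hw]; ring
    · rw [hw]; ring
    · rw [hw]; ring
  refine ⟨_, _, _, jet, c1, c2, ?_⟩
  -- The `τ` term adds `w²` to the second derivative and `2 w³` to the third; both `√P` and `|w|`
  -- are at most `√(P + w²)`.
  set P := -(a₂ - a₁ ^ 2) + Triangulation.sigma p * r ^ 2 with hP
  have m1 : √P ≤ √(P + w ^ 2) := Real.sqrt_le_sqrt (by nlinarith)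
  have m2 : |w| ≤ √(P + w ^ 2) := by
    rw [← Real.sqrt_sq_eq_abs]; exact Real.sqrt_le_sqrt (by linarith)
  calc _ ≤ 2 * (P * √P) + |2 * w ^ 3| := (abs_add_le _ _).trans (add_le_add_left c3 _)
    _ = 2 * (P * √P) + 2 * (w ^ 2 * |w|) := by
      rw [abs_mul, abs_two, abs_pow, ← sq_abs w]; ring
    _ ≤ 2 * (P * √(P + w ^ 2)) + 2 * (w ^ 2 * √(P + w ^ 2)) := by gcongr
    _ = _ := by ring

variable [Fintype ι]

lemma isOpen_strictRegion (hp : 0 < p) : IsOpen (strictRegion p R A b ω) := by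
  have : strictRegion p R A b ω =
      ⋂ i, {x | 0 < slack p A b x i} ∩ {x | 0 < x.2 i} ∩ {x | 0 < R - ω i * x.2 i} := by
    ext x
    simp only [strictRegion, mem_iInter, mem_inter_iff, mem_ofPred_eq, and_assoc]
  rw [this]
  refine isOpen_iInter_of_finite fun i =>
    ((isOpen_lt continuous_const (continuous_slack hp i)).inter
    (isOpen_lt continuous_const (by fun_prop))).inter
    (isOpen_lt continuous_const (by fun_prop))

lemma interior_region (hp : 0 < p) (hω : ∀ i, 0 < ω i) :
    interior (region p R A b ω) = strictRegion p R A b ω := by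
  classical
  apply Subset.antisymm
  · intro x hx i
    -- Only `s_i` is moved: room to decrease it makes the first two constraints strict, and room to
    -- increase it makes the third strict because `ω_i > 0`.
    have hc : Continuous fun t : ℝ => (x.1, x.2 + Pi.single i t) :=
      continuous_const.prodMk (continuous_const.add (continuous_single (A := fun _ : ι => ℝ) i))
    have hx0 : (x.1, x.2 + Pi.single i (0 : ℝ)) = x := by simp
    have hev : ∀ᶠ t : ℝ in 𝓝 0, (x.1, x.2 + Pi.single i t) ∈ region p R A b ω := by
      refine hc.continuousAt.eventually (mem_interior_iff_mem_nhds.1 ?_)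
      simp only [hx0]; exact hx
    obtain ⟨ε, hε, hball⟩ := Metric.eventually_nhds_iff.1 hev
    have h1 := hball (y := ε / 2) (by simp [abs_of_pos hε, hε]) i
    have h2 := hball (y := -(ε / 2)) (by simp [abs_of_pos hε, hε]) i
    simp only [Pi.add_apply, Pi.single_eq_same] at h1 h2
    have h3 : ‖A i x.1 + b i‖ ^ p < x.2 i := by linarith [h2.1]
    have h4 : 0 < x.2 i := by linarith [h2.2.1]
    refine ⟨(pow_lt_iff hp (norm_nonneg _) h4.le).1 h3, h4, ?_⟩
    have := mul_pos (hω i) (half_pos hε)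
    nlinarith [h1.2.2]
  · refine interior_maximal (fun x hx => ?_) (isOpen_strictRegion hp)
    rw [mem_region_iff hp]
    exact fun i => ⟨(hx i).1.le, (hx i).2.1.le, (hx i).2.2.le⟩

lemma contDiffOn_term (i : ι) :
    ContDiffOn ℝ 3 (fun x => term p R A b ω x i) (strictRegion p R A b ω) := by
  intro x hx
  obtain ⟨h1, h2, h3⟩ := hx i
  refine ContDiffAt.contDiffWithinAt ?_
  have k2 : ContDiffAt ℝ 3 (fun x : V × (ι → ℝ) => x.2 i) x := by fun_prop
  have k1 : ContDiffAt ℝ 3 (fun x => slack p A b x i) x := by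
    unfold slack
    refine (k2.rpow_const_of_ne h2.ne').sub (ContDiffAt.norm_sq ℝ ?_)
    fun_prop
  have k3 : ContDiffAt ℝ 3 (fun x : V × (ι → ℝ) => R - ω i * x.2 i) x := by fun_prop
  unfold term
  exact ((k1.log h1.ne').neg.sub (contDiffAt_const.mul (k2.log h2.ne'))).sub (k3.log h3.ne')

end PowerEpigraph

/-! ### Convexity from jets, and logarithms near the boundary -/

namespace HasJet

lemma convexOn {φ : ℝ → ℝ} {D : Set ℝ} (hD : Convex ℝ D)
    (h : ∀ t ∈ D, ∃ a b c, HasJet (fun s => φ (t + s)) a b c ∧ 0 ≤ b) : ConvexOn ℝ D φ := by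
  have key : ∀ t ∈ D, DifferentiableAt ℝ φ t ∧ DifferentiableAt ℝ (deriv φ) t ∧
      0 ≤ deriv (deriv φ) t := by
    intro t ht
    obtain ⟨a, b, c, ⟨φ₁, φ₂, h₁, h₂, -, -, rfl⟩, hb⟩ := h t ht
    have shift : ∀ {f : ℝ → ℝ} {f' : ℝ}, HasDerivAt (fun s => f (t + s)) f' 0 →
        HasDerivAt f f' t := by
      intro f f' hf
      have := HasDerivAt.comp_sub_const t t (f := fun s => f (t + s)) (by simpa using hf)
      simpa using this
    have e₁ : (fun s => deriv φ (t + s)) =ᶠ[𝓝 0] φ₁ := by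
      filter_upwards [h₁] with s hs
      rw [← hs.deriv, deriv_comp_const_add]
    have d₂ : HasDerivAt (deriv φ) (φ₂ 0) t :=
      shift (h₂.self_of_nhds.congr_of_eventuallyEq e₁)
    exact ⟨(shift h₁.self_of_nhds).differentiableAt, d₂.differentiableAt, by rwa [d₂.deriv]⟩
  exact convexOn_of_deriv2_nonneg' hD (fun t ht => (key t ht).1.differentiableWithinAt)
    (fun t ht => (key t ht).2.1.differentiableWithinAt) (fun t ht => (key t ht).2.2)

end HasJet

lemma sigma_pos (p : ℝ) : 0 < Triangulation.sigma p := by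
  unfold Triangulation.sigma; split_ifs <;> norm_num

/-- Near `y` the function stays below `c y + 1`, so the bound persists even where `c` vanishes. -/
lemma eventually_le_neg_log {X : Type*} [TopologicalSpace X] {c : X → ℝ} (hc : Continuous c)
    (y : X) : ∃ K, ∀ᶠ x in 𝓝 y, 0 < c x → K ≤ -Real.log (c x) := by
  refine ⟨-Real.log (c y + 1), ?_⟩
  filter_upwards [hc.continuousAt.eventually (gt_mem_nhds (lt_add_one (c y)))] with x hx h0
  exact neg_le_neg (Real.log_le_log h0 hx.le)

lemma tendsto_neg_log_atTop {X : Type*} [TopologicalSpace X] {c : X → ℝ} (hc : Continuous c)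
    {y : X} {S : Set X} (hy : c y = 0) (hS : ∀ x ∈ S, 0 < c x) :
    Tendsto (fun x => -Real.log (c x)) (𝓝[S] y) atTop := by
  refine tendsto_neg_atBot_atTop.comp (Real.tendsto_log_nhdsGT_zero.comp ?_)
  refine tendsto_nhdsWithin_iff.2 ⟨?_, ?_⟩
  · rw [← hy]; exact hc.continuousAt.tendsto.mono_left nhdsWithin_le_nhds
  · filter_upwards [self_mem_nhdsWithin] with x hx using hS x hx

/-! ### Blow-up at the boundary, summation over the indices, and the barrier theorem -/

namespace PowerEpigraph

variable {ι V W : Type*} [NormedAddCommGroup V] [NormedSpace ℝ V]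
  [NormedAddCommGroup W] [InnerProductSpace ℝ W]
  {p R : ℝ} {A : ι → V →L[ℝ] W} {b : ι → W} {ω : ι → ℝ}

lemma eventually_le_term (hp : 1 ≤ p) (y : V × (ι → ℝ)) (i : ι) :
    ∃ K, ∀ᶠ x in 𝓝[strictRegion p R A b ω] y, K ≤ term p R A b ω x i := by
  obtain ⟨K₁, h₁⟩ := eventually_le_neg_log
    (continuous_slack (A := A) (b := b) (by linarith : 0 < p) i) y
  obtain ⟨K₂, h₂⟩ := eventually_le_neg_log (by fun_prop : Continuous fun x : V × (ι → ℝ) => x.2 i) y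
  obtain ⟨K₃, h₃⟩ := eventually_le_neg_log
    (by fun_prop : Continuous fun x : V × (ι → ℝ) => R - ω i * x.2 i) y
  refine ⟨K₁ + Triangulation.sigma p * K₂ + K₃, ?_⟩
  filter_upwards [nhdsWithin_le_nhds h₁, nhdsWithin_le_nhds h₂, nhdsWithin_le_nhds h₃,
    self_mem_nhdsWithin] with x k₁ k₂ k₃ hx
  have := mul_le_mul_of_nonneg_left (k₂ (hx i).2.1) (sigma_pos p).le
  have := k₁ (hx i).1
  have := k₃ (hx i).2.2
  unfold term
  linarith

lemma tendsto_term (hp : 1 ≤ p) {y : V × (ι → ℝ)} (i : ι) (hy : y ∈ region p R A b ω)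
    (hi : ¬(0 < slack p A b y i ∧ 0 < y.2 i ∧ 0 < R - ω i * y.2 i)) :
    Tendsto (fun x => term p R A b ω x i) (𝓝[strictRegion p R A b ω] y) atTop := by
  have hp0 : 0 < p := by linarith
  obtain ⟨y₁, y₂, y₃⟩ := (mem_region_iff hp0).1 hy i
  have c₁ := continuous_slack (A := A) (b := b) hp0 i
  have c₃ : Continuous fun x : V × (ι → ℝ) => R - ω i * x.2 i := by fun_prop
  obtain ⟨K₁, h₁⟩ := eventually_le_neg_log c₁ y
  obtain ⟨K₂, h₂⟩ := eventually_le_neg_log (by fun_prop : Continuous fun x : V × (ι → ℝ) => x.2 i) y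
  obtain ⟨K₃, h₃⟩ := eventually_le_neg_log c₃ y
  -- The case `s_i = 0` needs no separate treatment: then `s_i ^ (2 / p) = 0`, and the nonnegative
  -- slack vanishes too.
  have h : slack p A b y i = 0 ∨ R - ω i * y.2 i = 0 := by
    by_contra! hne
    refine hi ⟨lt_of_le_of_ne y₁ hne.1.symm, lt_of_le_of_ne y₂ fun h0 => hne.1 ?_,
      lt_of_le_of_ne y₃ hne.2.symm⟩
    refine le_antisymm ?_ y₁
    unfold slack
    rw [← h0, Real.zero_rpow (by positivity)]
    linarith [sq_nonneg ‖A i y.1 + b i‖]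
  rcases h with h | h
  · have := tendsto_neg_log_atTop (S := strictRegion p R A b ω) c₁ h fun x hx => (hx i).1
    refine tendsto_atTop_mono' _ ?_
      (tendsto_atTop_add_const_right _ (Triangulation.sigma p * K₂ + K₃) this)
    filter_upwards [nhdsWithin_le_nhds h₂, nhdsWithin_le_nhds h₃, self_mem_nhdsWithin]
      with x k₂ k₃ hx
    have := mul_le_mul_of_nonneg_left (k₂ (hx i).2.1) (sigma_pos p).le
    have := k₃ (hx i).2.2
    unfold term
    linarith
  · have := tendsto_neg_log_atTop (S := strictRegion p R A b ω) c₃ h fun x hx => (hx i).2.2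
    refine tendsto_atTop_mono' _ ?_
      (tendsto_atTop_add_const_right _ (K₁ + Triangulation.sigma p * K₂) this)
    filter_upwards [nhdsWithin_le_nhds h₁, nhdsWithin_le_nhds h₂, self_mem_nhdsWithin]
      with x k₁ k₂ hx
    have := mul_le_mul_of_nonneg_left (k₂ (hx i).2.1) (sigma_pos p).le
    have := k₁ (hx i).1
    unfold term
    linarith

variable [Fintype ι]

/-- The barrier, restricted to a line. -/
lemma exists_hasJet_sum (hp : 1 ≤ p) (hω : ∀ i, 0 < ω i) {x : V × (ι → ℝ)}
    (hx : x ∈ strictRegion p R A b ω) (h : V × (ι → ℝ)) :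
    ∃ a₁ a₂ a₃ : ℝ, HasJet (fun t : ℝ => ∑ i, term p R A b ω (x + t • h) i) a₁ a₂ a₃ ∧
      a₁ ^ 2 ≤ Fintype.card ι * (Triangulation.sigma p + 2) * a₂ ∧ 0 ≤ a₂ ∧
      |a₃| ≤ 2 * (a₂ * √a₂) := by
  choose a₁ a₂ a₃ hj h₁ h₂ h₃ using fun i => exists_hasJet_term hp hω hx h i
  refine ⟨_, _, _, HasJet.sum Finset.univ fun i _ => hj i, ?_,
    Finset.sum_nonneg fun i _ => h₂ i, ?_⟩
  -- Cauchy-Schwarz over the indices produces the factor `m` of the barrier parameter.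
  · calc (∑ i, a₁ i) ^ 2 ≤ (Finset.univ : Finset ι).card * ∑ i, a₁ i ^ 2 :=
          sq_sum_le_card_mul_sum_sq
      _ ≤ Fintype.card ι * ∑ i, (Triangulation.sigma p + 2) * a₂ i := by
          rw [Finset.card_univ]
          gcongr with i
          exact h₁ i
      _ = _ := by rw [← Finset.mul_sum, mul_assoc]
  · calc |∑ i, a₃ i| ≤ ∑ i, |a₃ i| := Finset.abs_sum_le_sum_abs _ _
      _ ≤ ∑ i, 2 * (a₂ i * √(a₂ i)) := Finset.sum_le_sum fun i _ => h₃ i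
      _ = 2 * ∑ i, a₂ i * √(a₂ i) := by rw [Finset.mul_sum]
      _ ≤ _ := by gcongr; exact sum_mul_sqrt_le _ fun i _ => h₂ i

lemma convexOn_sum_term (hp : 1 ≤ p) (hω : ∀ i, 0 < ω i) :
    ConvexOn ℝ (strictRegion p R A b ω) fun x => ∑ i, term p R A b ω x i := by
  have hconv : Convex ℝ (strictRegion p R A b ω) := by
    have h : Convex ℝ (region p R A b ω) := convex_region hp
    rw [← interior_region (by linarith) hω]
    exact h.interior
  refine ⟨hconv, fun x hx y hy α β hα hβ hαβ => ?_⟩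
  have hseg : ∀ t ∈ Icc (0 : ℝ) 1, x + t • (y - x) ∈ strictRegion p R A b ω := fun t ht =>
    hconv.add_smul_sub_mem hx hy ht
  have hc : ConvexOn ℝ (Icc (0 : ℝ) 1)
      fun t => ∑ i, term p R A b ω (x + t • (y - x)) i := by
    refine HasJet.convexOn (convex_Icc 0 1) fun t ht => ?_
    obtain ⟨a₁, a₂, a₃, hj, -, h₂, -⟩ := exists_hasJet_sum hp hω (hseg t ht) (y - x)
    refine ⟨a₁, a₂, a₃, ?_, h₂⟩
    simpa only [add_smul, add_assoc] using hj
  have key := hc.2 (left_mem_Icc.2 zero_le_one) (right_mem_Icc.2 zero_le_one) hα hβ hαβ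
  have e : x + β • (y - x) = α • x + β • y := by
    rw [eq_sub_of_add_eq hαβ]; module
  have e₀ : x + (0 : ℝ) • (y - x) = x := by module
  have e₁ : x + (1 : ℝ) • (y - x) = y := by module
  have e₂ : α • (0 : ℝ) + β • (1 : ℝ) = β := by simp
  simp only [e₂, e, e₀, e₁] at key
  exact key

lemma tendsto_sum_term (hp : 1 ≤ p) {y : V × (ι → ℝ)} (hy : y ∈ region p R A b ω)
    (hyS : y ∉ strictRegion p R A b ω) :
    Tendsto (fun x => ∑ i, term p R A b ω x i) (𝓝[strictRegion p R A b ω] y) atTop := by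
  classical
  obtain ⟨i, hi⟩ := not_forall.1 hyS
  choose K hK using fun j => eventually_le_term (R := R) (A := A) (b := b) (ω := ω) hp y j
  simp only [← Finset.add_sum_erase _ _ (Finset.mem_univ i)]
  refine tendsto_atTop_add_right_of_le' _ (∑ j ∈ Finset.univ.erase i, K j)
    (tendsto_term hp i hy hi) ?_
  filter_upwards [eventually_all.2 hK] with x hx
  exact Finset.sum_le_sum fun j _ => hx j

theorem isSelfConcordantBarrier (hp : 1 ≤ p) (hω : ∀ i, 0 < ω i)
    (hne : (interior (region p R A b ω)).Nonempty) :
    IsSelfConcordantBarrier (fun x => ∑ i, term p R A b ω x i) (region p R A b ω)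
      (Fintype.card ι * (Triangulation.sigma p + 2)) := by
  have hp0 : 0 < p := by linarith
  have hint : interior (region p R A b ω) = strictRegion p R A b ω := interior_region hp0 hω
  refine ⟨isClosed_region hp0, convex_region hp, hne, ?_, ?_, ?_, ?_, ?_⟩
  · rw [hint]
    exact ContDiffOn.sum fun i _ => contDiffOn_term i
  · rw [hint]
    exact convexOn_sum_term hp hω
  · intro y hy
    have hyS : y ∉ strictRegion p R A b ω := by rw [← hint]; exact hy.2
    rw [hint]
    exact tendsto_sum_term hp ((isClosed_region hp0).frontier_subset hy) hyS
  · intro x hx h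
    rw [hint] at hx
    obtain ⟨a₁, a₂, a₃, hj, -, h₂, h₃⟩ := exists_hasJet_sum hp hω hx h
    obtain ⟨-, e₂, e₃⟩ := hj.iteratedDeriv_eq
    unfold dirDeriv
    rw [e₂, e₃, rpow_three_halves h₂]
    exact h₃
  · intro x hx h
    rw [hint] at hx
    obtain ⟨a₁, a₂, a₃, hj, h₁, -, -⟩ := exists_hasJet_sum hp hω hx h
    obtain ⟨e₁, e₂, -⟩ := hj.iteratedDeriv_eq
    unfold dirDeriv
    rw [e₁, e₂]
    exact h₁

end PowerEpigraph

/-! ## Geometry of the triangulation and integration over its cells -/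

namespace Triangulation

variable {d : ℕ} (T : Triangulation d)

lemma simplex_eq_convexHull_affBasis (i : Fin T.numCells) :
    T.simplex i = convexHull ℝ (range (T.affBasis i)) := by
  rw [simplex, ← range_comp]; rfl

lemma interior_simplex (i : Fin T.numCells) :
    interior (T.simplex i) = {x | ∀ a, 0 < (T.affBasis i).coord a x} := by
  rw [simplex_eq_convexHull_affBasis, AffineBasis.interior_convexHull]

lemma isCompact_simplex (i : Fin T.numCells) : IsCompact (T.simplex i) :=
  ((finite_range (T.cell i)).image T.node).isCompact_convexHull (𝕜 := ℝ)

lemma convex_simplex (i : Fin T.numCells) : Convex ℝ (T.simplex i) :=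
  convex_convexHull ℝ _

lemma cell_apply_injective (i : Fin T.numCells) : Function.Injective (T.cell i) :=
  Function.Injective.of_comp (f := T.node) (T.affineIndependent i).injective

/-- A simplex which meets the interior of `K_i` is `K_i`. -/
lemma eq_of_mem_interior_simplex {i j : Fin T.numCells} {x : EuclideanSpace ℝ (Fin d)}
    (hi : x ∈ interior (T.simplex i)) (hj : x ∈ T.simplex j) : i = j := by
  have hx : x ∈ convexHull ℝ (T.node '' (range (T.cell i) ∩ range (T.cell j))) := by
    rw [← T.conforming i j]; exact ⟨interior_subset hi, hj⟩
  rw [interior_simplex] at hi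
  refine T.cell_injective i j (eq_of_subset_of_ncard_le ?_ ?_)
  · rintro _ ⟨a, rfl⟩
    by_contra ha
    -- A vertex of `K_i` missing from `K_j` would have zero barycentric coordinate on the whole
    -- common face, yet this coordinate is positive in the interior of `K_i`. Inclusion of vertex
    -- sets is then equality, as both have `d + 1` elements.
    have hsub : convexHull ℝ (T.node '' (range (T.cell i) ∩ range (T.cell j))) ⊆
        (T.affBasis i).coord a ⁻¹' {0} := by
      refine convexHull_min ?_ ((convex_singleton 0).affine_preimage _)
      rintro _ ⟨_, ⟨⟨b, rfl⟩, hb⟩, rfl⟩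
      have hab : a ≠ b := by rintro rfl; exact ha hb
      exact (T.affBasis i).coord_apply_ne hab
    exact (hi a).ne' (hsub hx)
  · rw [ncard_range_of_injective (T.cell_apply_injective i),
      ncard_range_of_injective (T.cell_apply_injective j)]

open Classical in
/-- The affine function which coincides with the hat function `φ_k` on `K_i`. -/
def localHat (i : Fin T.numCells) (k : Fin T.numNodes) : EuclideanSpace ℝ (Fin d) →ᵃ[ℝ] ℝ :=
  ∑ a, if T.cell i a = k then (T.affBasis i).coord a else 0

open Classical in
lemma localHat_apply (i : Fin T.numCells) (k : Fin T.numNodes) (x : EuclideanSpace ℝ (Fin d)) :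
    T.localHat i k x = ∑ a, if T.cell i a = k then (T.affBasis i).coord a x else 0 := by
  have : ∀ s : Finset (Fin (d + 1)),
      (∑ a ∈ s, if T.cell i a = k then (T.affBasis i).coord a else 0 :
        EuclideanSpace ℝ (Fin d) →ᵃ[ℝ] ℝ) x =
      ∑ a ∈ s, if T.cell i a = k then (T.affBasis i).coord a x else 0 := fun s => by
    induction s using Finset.induction_on with
    | empty => simp
    | insert a s ha ih =>
      rw [Finset.sum_insert ha, Finset.sum_insert ha, ← ih, AffineMap.coe_add, Pi.add_apply]
      split_ifs <;> simp
  exact this _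

/-- The simplex chosen in `hat` can only be `K_i`, no other one containing an interior point of
`K_i`. -/
lemma hat_eq_localHat {i : Fin T.numCells} (k : Fin T.numNodes) {x : EuclideanSpace ℝ (Fin d)}
    (hx : x ∈ interior (T.simplex i)) : T.hat k x = T.localHat i k x := by
  have h : ∃ i, x ∈ T.simplex i := ⟨i, interior_subset hx⟩
  have hi : h.choose = i := (T.eq_of_mem_interior_simplex hx h.choose_spec).symm
  rw [localHat_apply, hat, dif_pos h, hi]

lemma hat_mem_Icc {i : Fin T.numCells} (k : Fin T.numNodes) {x : EuclideanSpace ℝ (Fin d)}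
    (hx : x ∈ interior (T.simplex i)) : T.hat k x ∈ Icc (0 : ℝ) 1 := by
  classical
  rw [hat_eq_localHat T k hx, localHat_apply]
  rw [interior_simplex] at hx
  constructor
  · exact Finset.sum_nonneg fun a _ => by split_ifs; exacts [(hx a).le, le_rfl]
  · rw [← (T.affBasis i).sum_coord_apply_eq_one x]
    exact Finset.sum_le_sum fun a _ => by split_ifs; exacts [le_rfl, (hx a).le]

lemma midpt_mem_interior (i : Fin T.numCells) : T.midpt i ∈ interior (T.simplex i) := by
  have h : T.midpt i = Finset.univ.centroid ℝ (T.affBasis i) := by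
    rw [Finset.centroid_def, Finset.affineCombination_eq_linear_combination _ _ _
      (Finset.sum_centroidWeights_eq_one_of_card_ne_zero ℝ _ (by simp))]
    simp [midpt, Finset.smul_sum, Finset.centroidWeights]
    rfl
  rw [interior_simplex]
  intro a
  rw [h, AffineBasis.coord_apply_centroid _ (Finset.mem_univ a)]
  simp
  positivity

/-- The derivative of the hat function `φ_k` on `K_i`. -/
def localDeriv (i : Fin T.numCells) (k : Fin T.numNodes) : EuclideanSpace ℝ (Fin d) →L[ℝ] ℝ :=
  (T.localHat i k).linear.toContinuousLinearMap

lemma hasFDerivAt_hat {i : Fin T.numCells} (k : Fin T.numNodes) {x : EuclideanSpace ℝ (Fin d)}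
    (hx : x ∈ interior (T.simplex i)) : HasFDerivAt (T.hat k) (T.localDeriv i k) x := by
  have h : HasFDerivAt (fun y => T.localDeriv i k y + T.localHat i k 0) (T.localDeriv i k) x :=
    (T.localDeriv i k).hasFDerivAt.add_const _
  refine h.congr_of_eventuallyEq ?_
  filter_upwards [isOpen_interior.mem_nhds hx] with y hy
  rw [hat_eq_localHat T k hy, AffineMap.decomp (T.localHat i k)]
  simp [localDeriv]

lemma hasFDerivAt_feFun (w : Fin T.numNodes → ℝ) {i : Fin T.numCells}
    {x : EuclideanSpace ℝ (Fin d)} (hx : x ∈ interior (T.simplex i)) :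
    HasFDerivAt (T.feFun w) (∑ k, w k • T.localDeriv i k) x :=
  HasFDerivAt.fun_sum fun k _ => (T.hasFDerivAt_hat k hx).const_mul (w k)

lemma gradient_feFun (w : Fin T.numNodes → ℝ) {i : Fin T.numCells}
    {x : EuclideanSpace ℝ (Fin d)} (hx : x ∈ interior (T.simplex i)) :
    gradient (T.feFun w) x = T.cellGrad w i := by
  rw [cellGrad, gradient, gradient, (T.hasFDerivAt_feFun w hx).fderiv,
    (T.hasFDerivAt_feFun w (T.midpt_mem_interior i)).fderiv]

lemma cellGrad_eq (w : Fin T.numNodes → ℝ) (i : Fin T.numCells) :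
    T.cellGrad w i =
      (InnerProductSpace.toDual ℝ _).symm (∑ k, w k • T.localDeriv i k) := by
  rw [cellGrad, gradient, (T.hasFDerivAt_feFun w (T.midpt_mem_interior i)).fderiv]

lemma cellGrad_add (w w' : Fin T.numNodes → ℝ) (i : Fin T.numCells) :
    T.cellGrad (w + w') i = T.cellGrad w i + T.cellGrad w' i := by
  simp only [cellGrad_eq, Pi.add_apply, add_smul, Finset.sum_add_distrib, map_add]

lemma cellGrad_smul (c : ℝ) (w : Fin T.numNodes → ℝ) (i : Fin T.numCells) :
    T.cellGrad (c • w) i = c • T.cellGrad w i := by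
  simp only [cellGrad_eq, Pi.smul_apply, smul_eq_mul, mul_smul, ← Finset.smul_sum, map_smul]

/-- Links the matrices of the barrier with the gradients that define `Q`. -/
lemma cellGrad_apply (w : Fin T.numNodes → ℝ) (i : Fin T.numCells) (j : Fin d) :
    T.cellGrad w i j = (T.discDeriv j).mulVec w i := by
  have h : T.cellGrad w i j = inner ℝ (T.cellGrad w i) (EuclideanSpace.single j (1 : ℝ)) := by
    simp [EuclideanSpace.inner_single_right]
  rw [h, cellGrad_eq, InnerProductSpace.toDual_symm_apply]
  simp only [Matrix.mulVec, dotProduct, discDeriv, sum_apply,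
    smul_apply, smul_eq_mul,
    (T.hasFDerivAt_hat _ (T.midpt_mem_interior i)).fderiv]
  exact Finset.sum_congr rfl fun k _ => mul_comm _ _

lemma extend_add (u v : T.FESpace) : T.extend (u + v) = T.extend u + T.extend v := by
  funext k; by_cases h : T.node k ∈ T.domain <;> simp [extend, h]

lemma extend_smul (c : ℝ) (u : T.FESpace) : T.extend (c • u) = c • T.extend u := by
  funext k; by_cases h : T.node k ∈ T.domain <;> simp [extend, h]

/-- The gradient on `K_i` as a continuous linear map on `V_h`. -/
def gradMap (i : Fin T.numCells) : T.FESpace →L[ℝ] EuclideanSpace ℝ (Fin d) :=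
  LinearMap.toContinuousLinearMap
    { toFun := fun u => T.cellGrad (T.extend u) i
      map_add' := fun u v => by rw [extend_add, cellGrad_add]
      map_smul' := fun c u => by rw [extend_smul, cellGrad_smul]; rfl }

lemma gradMap_add (g : Fin T.numNodes → ℝ) (u : T.FESpace) (i : Fin T.numCells) :
    T.gradMap i u + T.cellGrad g i = T.cellGrad (T.extend u + g) i :=
  (T.cellGrad_add _ _ i).symm

lemma weight_pos (i : Fin T.numCells) : 0 < T.weight i := by
  refine ENNReal.toReal_pos (ne_of_gt ?_) (T.isCompact_simplex i).measure_lt_top.ne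
  exact (isOpen_interior.measure_pos volume ⟨_, T.midpt_mem_interior i⟩).trans_le
    (measure_mono interior_subset)

/-- The difference lies in the frontiers of the simplices, which are null by convexity. -/
lemma domain_ae_eq : T.domain =ᵐ[volume] ⋃ i, interior (T.simplex i) := by
  refine EventuallyLE.antisymm ?_ ?_
  · rw [ae_le_set]
    refine measure_mono_null (t := ⋃ i, frontier (T.simplex i)) ?_
      (measure_iUnion_null fun i => (T.convex_simplex i).addHaar_frontier volume)
    rintro x ⟨hx, hx'⟩
    obtain ⟨i, hi⟩ := mem_iUnion.1 (interior_subset hx)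
    exact mem_iUnion.2 ⟨i, subset_closure hi, fun h => hx' (mem_iUnion.2 ⟨i, h⟩)⟩
  · refine LE.le.eventuallyLE (iUnion_subset fun i => ?_)
    exact interior_mono (subset_iUnion T.simplex i)

lemma volume_interior_simplex (i : Fin T.numCells) :
    volume.real (interior (T.simplex i)) = T.weight i := by
  rw [weight, measureReal_def, measure_congr
    (interior_ae_eq_of_null_frontier ((T.convex_simplex i).addHaar_frontier volume))]

lemma pairwise_disjoint_interior :
    Pairwise (Function.onFun Disjoint fun i => interior (T.simplex i)) := fun _ _ hij =>
  disjoint_left.2 fun _ hi hj =>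
    hij (T.eq_of_mem_interior_simplex hi (interior_subset hj))

lemma setIntegral_norm_gradient (p : ℝ) (w : Fin T.numNodes → ℝ) :
    ∫ x in T.domain, ‖gradient (T.feFun w) x‖ ^ p = ∑ i, T.weight i * ‖T.cellGrad w i‖ ^ p := by
  have hc : ∀ i, EqOn (fun _ => ‖T.cellGrad w i‖ ^ p)
      (fun x => ‖gradient (T.feFun w) x‖ ^ p) (interior (T.simplex i)) := fun i x hx => by
    simp only [T.gradient_feFun w hx]
  rw [setIntegral_congr_set T.domain_ae_eq, integral_iUnion_fintype
    (fun i => isOpen_interior.measurableSet) T.pairwise_disjoint_interior]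
  · refine Finset.sum_congr rfl fun i _ => ?_
    rw [← setIntegral_congr_fun isOpen_interior.measurableSet (hc i), setIntegral_const,
      volume_interior_simplex, smul_eq_mul]
  · intro i
    refine IntegrableOn.congr_fun ?_ (hc i) isOpen_interior.measurableSet
    exact integrableOn_const
      ((measure_mono interior_subset).trans_lt (T.isCompact_simplex i).measure_lt_top).ne

/-- On cell interiors the hat function is affine with values in `[0, 1]`; its values on the
remaining null set do not matter. -/
lemma integrableOn_mul_hat {f : EuclideanSpace ℝ (Fin d) → ℝ}
    (hf : IntegrableOn f T.domain volume) (k : Fin T.numNodes) :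
    IntegrableOn (fun x => f x * T.hat k x) T.domain volume := by
  have hr : volume.restrict T.domain = volume.restrict (⋃ i, interior (T.simplex i)) :=
    Measure.restrict_congr_set T.domain_ae_eq
  refine Integrable.mul_bdd (c := 1) hf ?_ ?_
  · rw [hr, aestronglyMeasurable_iUnion_iff]
    intro i
    refine ((T.localHat i k).continuous_of_finiteDimensional.aestronglyMeasurable).congr ?_
    filter_upwards [ae_restrict_mem isOpen_interior.measurableSet] with x hx
    exact (T.hat_eq_localHat k hx).symm
  · rw [hr]
    filter_upwards [ae_restrict_mem
      (MeasurableSet.iUnion fun i => isOpen_interior.measurableSet)] with x hx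
    obtain ⟨i, hi⟩ := mem_iUnion.1 hx
    obtain ⟨h0, h1⟩ := T.hat_mem_Icc k hi
    rwa [Real.norm_of_nonneg h0]

lemma feFun_extend (u : T.FESpace) (x : EuclideanSpace ℝ (Fin d)) :
    T.feFun (T.extend u) x = ∑ k, u k * T.hat k.1 x := by
  symm
  refine Fintype.sum_of_injective Subtype.val Subtype.val_injective _ _ ?_ ?_
  · intro k hk
    have : T.node k ∉ T.domain := by simpa using hk
    simp [extend, this]
  · rintro ⟨k, hk⟩
    simp [extend, hk]

lemma setIntegral_mul_feFun {f : EuclideanSpace ℝ (Fin d) → ℝ}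
    (hf : IntegrableOn f T.domain volume) (u : T.FESpace) :
    ∫ x in T.domain, f x * T.feFun (T.extend u) x =
      ∑ k, u k * ∫ x in T.domain, f x * T.hat k.1 x := by
  have : ∀ x, f x * T.feFun (T.extend u) x = ∑ k, u k * (f x * T.hat k.1 x) := fun x => by
    rw [feFun_extend, Finset.mul_sum]
    exact Finset.sum_congr rfl fun k _ => by ring
  simp only [this]
  rw [integral_finsetSum _ fun k _ => (T.integrableOn_mul_hat hf k.1).const_mul (u k)]
  exact Finset.sum_congr rfl fun k _ => integral_const_mul _ _

/-! ## The two problems -/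

section Problems

variable {T} {p R : ℝ} {g : Fin T.numNodes → ℝ} {f : EuclideanSpace ℝ (Fin d) → ℝ}

/-- The vector of the values `‖∇(u+g)|_{K_i}‖ ^ p`. -/
def gradPow (T : Triangulation d) (p : ℝ) (g : Fin T.numNodes → ℝ) (u : T.FESpace)
    (i : Fin T.numCells) : ℝ :=
  ‖T.cellGrad (T.extend u + g) i‖ ^ p

/-- The gradient is constant on each cell, so the first integral is a sum weighted by volumes; the
second is linear in the nodal values. -/
lemma energy_eq_cost (hf : IntegrableOn f T.domain volume) (u : T.FESpace) :
    T.energy p g f u = T.cost p f (u, T.gradPow p g u) := by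
  rw [energy, cost, setIntegral_norm_gradient, setIntegral_mul_feFun T hf, Finset.mul_sum,
    sub_eq_neg_add, ← Finset.sum_neg_distrib]
  simp only [costVec, gradPow]
  congr 1
  · exact Finset.sum_congr rfl fun k _ => by ring
  · exact Finset.sum_congr rfl fun i _ => by ring

lemma mk_gradPow_mem {u : T.FESpace} (hu : u ∈ T.feasible p R g) :
    (u, T.gradPow p g u) ∈ T.setQ p R g := fun i =>
  ⟨le_rfl, Real.rpow_nonneg (norm_nonneg _) _, hu i⟩

lemma fst_mem_feasible {u : T.FESpace} {s : Fin T.numCells → ℝ} (h : (u, s) ∈ T.setQ p R g) :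
    u ∈ T.feasible p R g := fun i =>
  (mul_le_mul_of_nonneg_left (h i).1 (T.weight_pos i).le).trans (h i).2.2

lemma cost_le_cost (hp : 0 < p) (u : T.FESpace) {s s' : Fin T.numCells → ℝ}
    (h : ∀ i, s i ≤ s' i) : T.cost p f (u, s) ≤ T.cost p f (u, s') := by
  unfold cost
  gcongr with i
  · exact div_nonneg (T.weight_pos i).le hp.le
  · exact h i

/-- Strictness comes from `ω_i / p > 0`; it forces the `s`-part of a minimizer to be the least
admissible one. -/
lemma cost_lt_cost (hp : 0 < p) (u : T.FESpace) {s s' : Fin T.numCells → ℝ}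
    (h : ∀ i, s i ≤ s' i) (hne : s ≠ s') : T.cost p f (u, s) < T.cost p f (u, s') := by
  obtain ⟨i, hi⟩ := Function.ne_iff.1 hne
  unfold cost
  refine add_lt_add_right (Finset.sum_lt_sum (fun j _ => ?_) ⟨i, Finset.mem_univ i, ?_⟩) _
  · exact mul_le_mul_of_nonneg_left (h j) (div_nonneg (T.weight_pos j).le hp.le)
  · exact mul_lt_mul_of_pos_left (lt_of_le_of_ne (h i) hi) (div_pos (T.weight_pos i) hp)

lemma setQ_eq_region :
    T.setQ p R g = PowerEpigraph.region p R T.gradMap (T.cellGrad g) T.weight := by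
  ext x
  refine forall_congr' fun i => ?_
  rw [gradMap_add]

lemma barrierF_eq_sum_term :
    T.barrierF p R g =
      fun x => ∑ i, PowerEpigraph.term p R T.gradMap (T.cellGrad g) T.weight x i := by
  funext x
  have hz : ∀ i, T.slackZ p g x i = PowerEpigraph.slack p T.gradMap (T.cellGrad g) x i := by
    intro i
    rw [slackZ, PowerEpigraph.slack, gradMap_add, EuclideanSpace.norm_sq_eq]
    congr 1
    refine Finset.sum_congr rfl fun j _ => ?_
    rw [cellGrad_apply, Matrix.mulVec_add, Pi.add_apply, Real.norm_eq_abs, sq_abs]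
  simp only [barrierF, PowerEpigraph.term, hz, slackTau, Finset.sum_sub_distrib,
    Finset.sum_neg_distrib, Finset.mul_sum]

end Problems

end Triangulation

end

theorem lemma6 {d : ℕ} (T : Triangulation d) (p R : ℝ) (hp : 1 ≤ p)
    (g : Fin T.numNodes → ℝ) (f : EuclideanSpace ℝ (Fin d) → ℝ)
    (hf : IntegrableOn f T.domain volume) :
    -- the barrier
    ((interior (T.setQ p R g)).Nonempty →
      IsSelfConcordantBarrier (T.barrierF p R g) (T.setQ p R g)
        ((T.numCells : ℝ) * (Triangulation.sigma p + 2))) ∧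
    -- `u` is feasible iff it extends to a point of `Q`
    T.feasible p R g = Prod.fst '' T.setQ p R g ∧
    -- for feasible `u`, the least cost of a point of `Q` over `u` is `J(u)`
    (∀ u ∈ T.feasible p R g,
      IsLeast {a | ∃ s, (u, s) ∈ T.setQ p R g ∧ T.cost p f (u, s) = a} (T.energy p g f u)) ∧
    -- the minimizers of the two problems correspond to each other
    (∀ (u : T.FESpace) (s : Fin T.numCells → ℝ),
      ((u, s) ∈ T.setQ p R g ∧ IsMinOn (T.cost p f) (T.setQ p R g) (u, s)) ↔
        (u ∈ T.feasible p R g ∧ IsMinOn (T.energy p g f) (T.feasible p R g) u ∧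
          s = fun i => ‖T.cellGrad (T.extend u + g) i‖ ^ p)) ∧
    -- the two problems have the same optimal value
    (∀ a : ℝ, IsGLB (T.energy p g f '' T.feasible p R g) a ↔
      IsGLB (T.cost p f '' T.setQ p R g) a) := by
  have hp0 : 0 < p := by linarith
  have hle : ∀ {u : T.FESpace} {s : Fin T.numCells → ℝ}, (u, s) ∈ T.setQ p R g →
      T.energy p g f u ≤ T.cost p f (u, s) := fun {u s} h => by
    rw [Triangulation.energy_eq_cost hf]
    exact Triangulation.cost_le_cost hp0 u fun i => (h i).1
  refine ⟨fun hne => ?_, ?_, ?_, ?_, ?_⟩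
  · rw [Triangulation.setQ_eq_region] at hne ⊢
    rw [Triangulation.barrierF_eq_sum_term]
    simpa using PowerEpigraph.isSelfConcordantBarrier hp T.weight_pos hne
  · ext u
    constructor
    · exact fun hu => ⟨_, Triangulation.mk_gradPow_mem hu, rfl⟩
    · rintro ⟨⟨u, s⟩, h, rfl⟩
      exact Triangulation.fst_mem_feasible h
  · intro u hu
    refine ⟨⟨_, Triangulation.mk_gradPow_mem hu, (Triangulation.energy_eq_cost hf u).symm⟩, ?_⟩
    rintro _ ⟨s, hs, rfl⟩
    exact hle hs
  · intro u s
    constructor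
    · rintro ⟨h, hmin⟩
      have hu := Triangulation.fst_mem_feasible h
      refine ⟨hu, fun v hv => ?_, ?_⟩
      · refine (hle h).trans ((hmin (Triangulation.mk_gradPow_mem hv)).trans_eq ?_)
        exact (Triangulation.energy_eq_cost hf v).symm
      · by_contra hne
        exact (Triangulation.cost_lt_cost hp0 u (fun i => (h i).1) (Ne.symm hne)).not_ge
          (hmin (Triangulation.mk_gradPow_mem hu))
    · rintro ⟨hu, hmin, rfl⟩
      refine ⟨Triangulation.mk_gradPow_mem hu, ?_⟩
      rintro ⟨v, s⟩ hv
      refine (Triangulation.energy_eq_cost hf u).symm.le.trans ?_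
      exact (hmin (Triangulation.fst_mem_feasible hv)).trans (hle hv)
  · intro a
    -- Every feasible energy is a cost, and every cost over `Q` dominates a feasible energy;
    -- comparing lower bounds avoids assuming that an infimum exists.
    have : lowerBounds (T.energy p g f '' T.feasible p R g) =
        lowerBounds (T.cost p f '' T.setQ p R g) := by
      ext c
      constructor
      · rintro hc _ ⟨⟨u, s⟩, h, rfl⟩
        exact (hc ⟨u, Triangulation.fst_mem_feasible h, rfl⟩).trans (hle h)
      · rintro hc _ ⟨u, hu, rfl⟩
        rw [Triangulation.energy_eq_cost hf]
        exact hc ⟨_, Triangulation.mk_gradPow_mem hu, rfl⟩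
    rw [IsGLB, IsGLB, this]
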